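/- There is a universal constant $C>0$ with the following property. Let $G=(V,E)$ be a finite simple graph on at least two vertices, with adjacency matrix $A$ and diagonal degree matrix $D$, and let $\tau$ be its spectral gap, i.e. the second smallest eigenvalue (with multiplicity) of the normalized Laplacian $D^{-1/2}(D-A)D^{-1/2}$, where $D^{-1/2}$ has entry $0$ at isolated vertices (this is $I-D^{-1/2}AD^{-1/2}$ if there are none). Assume $\tau>0$. Let $x\in\mathbb{C}^M$ and $\{\varphi_i\}_{i\in V}\subseteq\mathbb{C}^M$, let $\langle x,\varphi\rangle=\varphi^*x$, and let $\varepsilon_{ij}\in\mathbb{C}$, for each ordered pair $(i,j)$ with $\{i,j\}\in E$, satisfy $\varepsilon_{ji}=\overline{\varepsilon_{ij}}$. Assume that $\overline{\langle x,\varphi_i\rangle}\langle x,\varphi_j\rangle+\varepsilon_{ij}\neq0$ for every $\{i,j\}\in E$, and put $$A_1[i,j]=\frac{\overline{\langle x,\varphi_i\rangle}\langle x,\varphi_j\rangle+\varepsilon_{ij}}{\big|\overline{\langle x,\varphi_i\rangle}\langle x,\varphi_j\rangle+\varepsilon_{ij}\big|}\quad(\{i,j\}\in E),\qquad A_1[i,j]=0\quad(\{i,j\}\notin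 E),$$ $$P=\min_{\{i,j\}\in E}\big|\overline{\langle x,\varphi_i\rangle}\langle x,\varphi_j\rangle+\varepsilon_{ij}\big|,\qquad \|\varepsilon\|^2=\sum_{\{i,j\}\in E}|\varepsilon_{ij}|^2.$$ Let $L_1=I-D^{-1/2}A_1^{\top}D^{-1/2}$ be the connection Laplacian (the assumption $\tau>0$ excludes isolated vertices). Angular synchronization takes an eigenvector $f\in\mathbb{C}^V$ of $L_1$ for its smallest eigenvalue and outputs $u\in\mathbb{C}^V$ with unit-modulus entries such that $u_i=f_i/|f_i|$ whenever $f_i\ne0$ (and $u_i$ is an arbitrary number of modulus one if $f_i=0$). Such an output exists, and for every such output $u$ (for every choice of eigenvector $f$ and of the entries $u_i$ with $f_i=0$) there is a phase $\theta\in\mathbb{R}/2\pi\mathbb{Z}$ such that $$\sum_{i\in V}\big\|\arg(u_i)-\arg(\langle x,\varphi_i\rangle)-\theta\big\|_{\mathbb{T}}^2\le\frac{C\,\|\varepsilon\|^2}{\tau^2P^2},$$ where $\|\theta\|_{\mathbb{T}}=\min_{k\in\mathbb{Z}}|\theta-2\pi k|$ for $\theta\in\mathbb{R}/2\pi\mathbb{Z}$,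 and $\arg(0)=0$. -/

import Mathlib

open scoped Matrix ComplexConjugate

namespace AngularSync

theorem adjMatrix_isHermitian {V : Type*} (G : SimpleGraph V) [DecidableRel G.Adj] :
    (G.adjMatrix ℂ).IsHermitian := by
  ext i j
  simp [Matrix.conjTranspose_apply, SimpleGraph.adjMatrix_apply, G.adj_comm, apply_ite]

variable {V : Type*} [Fintype V] [DecidableEq V]

/-- The diagonal matrix `D` of vertex degrees. -/
def degMatrix (G : SimpleGraph V) [DecidableRel G.Adj] : Matrix V V ℂ :=
  Matrix.diagonal fun v => (G.degree v : ℂ)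

/-- The diagonal matrix `D^{-1/2}`, with the usual convention that the entry at an isolated
vertex is `0`. -/
noncomputable def degInvSqrt (G : SimpleGraph V) [DecidableRel G.Adj] : Matrix V V ℂ :=
  Matrix.diagonal fun v => (((Real.sqrt (G.degree v))⁻¹ : ℝ) : ℂ)

/-- The normalized Laplacian `D^{-1/2} (D - W) D^{-1/2}` of `G` with edge weights `W`.
If `G` has no isolated vertex, this is `I - D^{-1/2} W D^{-1/2}`
(see `normalizedLaplacian_eq`). At an isolated vertex the diagonal entry is `0`, so that every
connected component contributes an eigenvalue `0` when `W` is the adjacency matrix. -/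
noncomputable def normalizedLaplacian (G : SimpleGraph V) [DecidableRel G.Adj]
    (W : Matrix V V ℂ) : Matrix V V ℂ :=
  degInvSqrt G * (degMatrix G - W) * degInvSqrt G

theorem normalizedLaplacian_eq (G : SimpleGraph V) [DecidableRel G.Adj]
    (W : Matrix V V ℂ) (hG : ∀ v, 0 < G.degree v) :
    normalizedLaplacian G W = 1 - degInvSqrt G * W * degInvSqrt G := by
  have h : degInvSqrt G * degMatrix G * degInvSqrt G = 1 := by
    rw [degInvSqrt, degMatrix, Matrix.diagonal_mul_diagonal, Matrix.diagonal_mul_diagonal,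
      ← Matrix.diagonal_one]
    congr 1
    funext v
    have hpos : (0 : ℝ) < G.degree v := by exact_mod_cast hG v
    have hs : Real.sqrt (G.degree v) ≠ 0 := (Real.sqrt_pos.2 hpos).ne'
    have hr : (Real.sqrt (G.degree v))⁻¹ * (G.degree v : ℝ) * (Real.sqrt (G.degree v))⁻¹ = 1 := by
      field_simp
      exact (Real.sq_sqrt hpos.le).symm
    exact_mod_cast hr
  rw [normalizedLaplacian, Matrix.mul_sub, Matrix.sub_mul, h]

theorem normalizedLaplacian_isHermitian (G : SimpleGraph V) [DecidableRel G.Adj]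
    {W : Matrix V V ℂ} (hW : W.IsHermitian) : (normalizedLaplacian G W).IsHermitian := by
  have h1 : (degInvSqrt G)ᴴ = degInvSqrt G := by
    rw [degInvSqrt, Matrix.diagonal_conjTranspose]
    congr 1
    funext v
    simp
  have h2 : (degMatrix G)ᴴ = degMatrix G := by
    rw [degMatrix, Matrix.diagonal_conjTranspose]
    congr 1
    funext v
    simp
  rw [Matrix.IsHermitian, normalizedLaplacian, Matrix.conjTranspose_mul, Matrix.conjTranspose_mul,
    Matrix.conjTranspose_sub, h1, h2, hW.eq, Matrix.mul_assoc]

/-- The spectral gap `λ₂` of `G`: the second smallest eigenvalue, counted with multiplicity, of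
the normalized Laplacian of `G`. (`eigenvalues₀` lists the eigenvalues in decreasing order.) -/
noncomputable def spectralGap [Nontrivial V] (G : SimpleGraph V) [DecidableRel G.Adj] : ℝ :=
  (normalizedLaplacian_isHermitian G (adjMatrix_isHermitian G)).eigenvalues₀
    ⟨Fintype.card V - 2, Nat.sub_lt Fintype.card_pos two_pos⟩

section Measurements

variable {M : ℕ}

/-- The inner product `⟨x, φ⟩ = φ* x`, linear in the first argument. -/
noncomputable def ip (x φ : EuclideanSpace ℂ (Fin M)) : ℂ := inner ℂ φ x

/-- The noisy edge product `conj ⟨x, φᵢ⟩ ⟨x, φⱼ⟩ + εᵢⱼ`. -/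
noncomputable def noisyProduct (x : EuclideanSpace ℂ (Fin M))
    (φ : V → EuclideanSpace ℂ (Fin M)) (ε : V → V → ℂ) (i j : V) : ℂ :=
  conj (ip x (φ i)) * ip x (φ j) + ε i j

/-- The weighted adjacency matrix `A₁` of normalized noisy edge products. -/
noncomputable def weightedAdj (G : SimpleGraph V) [DecidableRel G.Adj]
    (x : EuclideanSpace ℂ (Fin M)) (φ : V → EuclideanSpace ℂ (Fin M)) (ε : V → V → ℂ) :
    Matrix V V ℂ :=
  Matrix.of fun i j =>
    if G.Adj i j then noisyProduct x φ ε i j / (‖noisyProduct x φ ε i j‖ : ℂ) else 0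

/-- `P`, the minimum over the edges of the modulus of the noisy edge product. -/
noncomputable def minEdgeModulus (G : SimpleGraph V)
    (x : EuclideanSpace ℂ (Fin M)) (φ : V → EuclideanSpace ℂ (Fin M)) (ε : V → V → ℂ) : ℝ :=
  ⨅ d : G.Dart, ‖noisyProduct x φ ε d.fst d.snd‖

/-- `‖ε‖²`, the sum of `|εᵢⱼ|²` over the undirected edges `{i, j}`. Each edge occurs as two
ordered pairs, with `|εⱼᵢ| = |εᵢⱼ|`. -/
noncomputable def noiseNormSq (G : SimpleGraph V) [DecidableRel G.Adj] (ε : V → V → ℂ) : ℝ :=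
  (∑ i, ∑ j, if G.Adj i j then ‖ε i j‖ ^ 2 else 0) / 2

end Measurements

/-- The connection Laplacian. Here `A₁ i j` is a measurement of `ωᵢ⁻¹ ωⱼ`, so it is `A₁ᵀ` that
acts on phase vectors:
`ω* (D - A₁ᵀ) ω = ∑_{ {i,j} ∈ E } |ωⱼ - A₁ i j ωᵢ|²` for unit-modulus `ω`. -/
noncomputable def connectionLaplacian (G : SimpleGraph V) [DecidableRel G.Adj]
    (A₁ : Matrix V V ℂ) : Matrix V V ℂ :=
  normalizedLaplacian G A₁ᵀ

/-- `u` is a possible output of angular synchronization: for some eigenvector `f` of the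
connection Laplacian for its smallest eigenvalue, every `u i` is a phase of `f i`, that is
`u i = f i / |f i|` if `f i ≠ 0`, and `u i` is any number of modulus one if `f i = 0`. -/
def IsAngularSyncOutput (G : SimpleGraph V) [DecidableRel G.Adj]
    (A₁ : Matrix V V ℂ) (u : V → ℂ) : Prop :=
  ∃ (μ : ℝ) (f : V → ℂ),
    IsLeast {ν : ℝ |
      Module.End.HasEigenvalue (Matrix.toLin' (connectionLaplacian G A₁)) (ν : ℂ)} μ ∧
    Module.End.HasEigenvector (Matrix.toLin' (connectionLaplacian G A₁)) (μ : ℂ) f ∧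
    ∀ i, ‖u i‖ = 1 ∧ f i = (‖f i‖ : ℂ) * u i

end AngularSync

namespace AngularSync

variable {V : Type*} [Fintype V]

theorem star_dotProduct_self_re (z : V → ℂ) : (star z ⬝ᵥ z).re = ∑ i, ‖z i‖ ^ 2 := by
  rw [dotProduct, Complex.re_sum]
  refine Finset.sum_congr rfl fun i _ => ?_
  rw [Pi.star_apply, Complex.star_def, Complex.conj_mul']
  norm_cast

variable [DecidableEq V]

/-- Coordinates of `z` in the eigenvector basis of `H`. -/
noncomputable def eigenCoord {H : Matrix V V ℂ} (hH : H.IsHermitian) (z : V → ℂ) : V → ℂ :=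
  (star (hH.eigenvectorUnitary : Matrix V V ℂ)) *ᵥ z

theorem star_eigenCoord_dotProduct {H : Matrix V V ℂ} (hH : H.IsHermitian) (z w : V → ℂ) :
    star (eigenCoord hH z) ⬝ᵥ eigenCoord hH w = star z ⬝ᵥ w := by
  rw [eigenCoord, eigenCoord, Matrix.star_mulVec, ← Matrix.dotProduct_mulVec,
    Matrix.mulVec_mulVec, ← Matrix.star_eq_conjTranspose, star_star,
    Matrix.mem_unitaryGroup_iff.1 hH.eigenvectorUnitary.2, Matrix.one_mulVec]

theorem eigenCoord_mulVec {H : Matrix V V ℂ} (hH : H.IsHermitian) (z : V → ℂ) (k : V) :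
    eigenCoord hH (H *ᵥ z) k = hH.eigenvalues k * eigenCoord hH z k := by
  have h := hH.spectral_theorem
  rw [Unitary.conjStarAlgAut_apply] at h
  have h2 : star (hH.eigenvectorUnitary : Matrix V V ℂ) * H =
      Matrix.diagonal (RCLike.ofReal ∘ hH.eigenvalues) *
        star (hH.eigenvectorUnitary : Matrix V V ℂ) := by
    refine (congrArg (star (hH.eigenvectorUnitary : Matrix V V ℂ) * ·) h).trans ?_
    rw [← mul_assoc, ← mul_assoc, Matrix.mem_unitaryGroup_iff'.1 hH.eigenvectorUnitary.2, one_mul]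
  rw [eigenCoord, Matrix.mulVec_mulVec, h2, ← Matrix.mulVec_mulVec, Matrix.mulVec_diagonal]
  rfl

theorem sum_norm_eigenCoord {H : Matrix V V ℂ} (hH : H.IsHermitian) (z : V → ℂ) :
    ∑ k, ‖eigenCoord hH z k‖ ^ 2 = ∑ i, ‖z i‖ ^ 2 := by
  rw [← star_dotProduct_self_re, star_eigenCoord_dotProduct, star_dotProduct_self_re]

theorem re_quadForm_eq_sum {H : Matrix V V ℂ} (hH : H.IsHermitian) (z : V → ℂ) :
    (star z ⬝ᵥ H *ᵥ z).re = ∑ k, hH.eigenvalues k * ‖eigenCoord hH z k‖ ^ 2 := by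
  rw [← star_eigenCoord_dotProduct hH, dotProduct, Complex.re_sum]
  refine Finset.sum_congr rfl fun k _ => ?_
  rw [eigenCoord_mulVec, Pi.star_apply, Complex.star_def, mul_left_comm, Complex.conj_mul']
  norm_cast

theorem hasEigenvalue_eigenvalues {H : Matrix V V ℂ} (hH : H.IsHermitian) (k : V) :
    Module.End.HasEigenvalue (Matrix.toLin' H) (hH.eigenvalues k : ℂ) := by
  refine Module.End.hasEigenvalue_of_hasEigenvector (x := ⇑(hH.eigenvectorBasis k)) ⟨?_, ?_⟩
  · rw [Module.End.mem_eigenspace_iff, Matrix.toLin'_apply, hH.mulVec_eigenvectorBasis]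
    ext i
    simp
  · intro h
    refine hH.eigenvectorBasis.toBasis.ne_zero k ?_
    rw [OrthonormalBasis.coe_toBasis]
    ext i
    exact congrFun h i

theorem exists_eigenvalues_eq {H : Matrix V V ℂ} (hH : H.IsHermitian) {ν : ℝ}
    (h : Module.End.HasEigenvalue (Matrix.toLin' H) (ν : ℂ)) :
    ∃ k, hH.eigenvalues k = ν := by
  obtain ⟨z, hz⟩ := h.exists_hasEigenvector
  by_contra! hne
  refine hz.2 ?_
  have h1 := hz.apply_eq_smul
  rw [Matrix.toLin'_apply] at h1
  have h0 : ∀ k, eigenCoord hH z k = 0 := by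
    intro k
    have h2 := eigenCoord_mulVec hH z k
    rw [h1, eigenCoord, Matrix.mulVec_smul, ← eigenCoord, Pi.smul_apply, smul_eq_mul] at h2
    have h3 : ((hH.eigenvalues k : ℂ) - ν) * eigenCoord hH z k = 0 := by
      rw [sub_mul, ← h2, sub_self]
    rcases mul_eq_zero.1 h3 with h4 | h4
    · exact absurd (by exact_mod_cast sub_eq_zero.1 h4) (hne k)
    · exact h4
  have h5 := sum_norm_eigenCoord hH z
  simp only [h0, norm_zero] at h5
  ext i
  have h6 := (Finset.sum_eq_zero_iff_of_nonneg (fun i _ => by positivity)).1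
    (h5.symm.trans (by simp)) i (Finset.mem_univ i)
  simpa using h6

/-- The smallest eigenvalue is a lower bound of the Rayleigh quotient. -/
theorem mul_sum_norm_le_re_quadForm {H : Matrix V V ℂ} (hH : H.IsHermitian) {μ : ℝ}
    (hμ : IsLeast {ν : ℝ | Module.End.HasEigenvalue (Matrix.toLin' H) (ν : ℂ)} μ) (z : V → ℂ) :
    μ * ∑ i, ‖z i‖ ^ 2 ≤ (star z ⬝ᵥ H *ᵥ z).re := by
  rw [re_quadForm_eq_sum hH, ← sum_norm_eigenCoord hH, Finset.mul_sum]
  gcongr with k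
  exact hμ.2 (hasEigenvalue_eigenvalues hH k)

theorem exists_isLeast_hasEigenvalue [Nonempty V] {H : Matrix V V ℂ} (hH : H.IsHermitian) :
    ∃ μ : ℝ, IsLeast {ν : ℝ | Module.End.HasEigenvalue (Matrix.toLin' H) (ν : ℂ)} μ := by
  obtain ⟨k, hk⟩ := Finite.exists_min hH.eigenvalues
  refine ⟨hH.eigenvalues k, hasEigenvalue_eigenvalues hH k, fun ν hν => ?_⟩
  obtain ⟨l, rfl⟩ := exists_eigenvalues_eq hH hν
  exact hk l

/-- On the orthogonal complement of a null vector, a Hermitian matrix whose second smallest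
eigenvalue is positive is bounded below by that eigenvalue. -/
theorem mul_sum_norm_le_of_orthogonal_ker [Nontrivial V] {H : Matrix V V ℂ} (hH : H.IsHermitian)
    (hpos : 0 < hH.eigenvalues₀ ⟨Fintype.card V - 2, Nat.sub_lt Fintype.card_pos two_pos⟩)
    {v z : V → ℂ} (hv : H *ᵥ v = 0) (hv0 : v ≠ 0) (hvz : star v ⬝ᵥ z = 0) :
    hH.eigenvalues₀ ⟨Fintype.card V - 2, Nat.sub_lt Fintype.card_pos two_pos⟩ * ∑ i, ‖z i‖ ^ 2
      ≤ (star z ⬝ᵥ H *ᵥ z).re := by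
  set τ := hH.eigenvalues₀ ⟨Fintype.card V - 2, Nat.sub_lt Fintype.card_pos two_pos⟩ with hτ
  let e : Fin (Fintype.card V) ≃ V := Fintype.equivOfCardEq (Fintype.card_fin _)
  let m : V := e ⟨Fintype.card V - 1, Nat.sub_lt Fintype.card_pos one_pos⟩
  have hge : ∀ k, k ≠ m → τ ≤ hH.eigenvalues k := by
    intro k hk
    refine hH.eigenvalues₀_antitone ?_
    have h1 : e.symm k ≠ ⟨Fintype.card V - 1, Nat.sub_lt Fintype.card_pos one_pos⟩ := by
      intro h
      exact hk (by rw [← e.apply_symm_apply k, h])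
    have h2 : ((e.symm k : Fin _) : ℕ) ≠ Fintype.card V - 1 := fun h => h1 (Fin.ext h)
    have h3 := (e.symm k).2
    change ((e.symm k : Fin _) : ℕ) ≤ Fintype.card V - 2
    omega
  have hvk : ∀ k, k ≠ m → eigenCoord hH v k = 0 := by
    intro k hk
    have h1 := eigenCoord_mulVec hH v k
    rw [hv, eigenCoord, Matrix.mulVec_zero, Pi.zero_apply, eq_comm, mul_eq_zero] at h1
    refine h1.resolve_left ?_
    exact_mod_cast (hpos.trans_le (hge k hk)).ne'
  have hvm : eigenCoord hH v m ≠ 0 := by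
    intro h
    have h5 := sum_norm_eigenCoord hH v
    have h0 : ∀ k, eigenCoord hH v k = 0 := fun k => by
      by_cases hk : k = m
      · rw [hk, h]
      · exact hvk k hk
    simp only [h0, norm_zero] at h5
    refine hv0 (funext fun i => ?_)
    have h6 := (Finset.sum_eq_zero_iff_of_nonneg (fun i _ => by positivity)).1
      (h5.symm.trans (by simp)) i (Finset.mem_univ i)
    simpa using h6
  have hzm : eigenCoord hH z m = 0 := by
    rw [← star_eigenCoord_dotProduct hH, dotProduct,
      Finset.sum_eq_single m (fun k _ hk => by simp [hvk k hk]) (by simp)] at hvz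
    simpa [hvm] using hvz
  rw [re_quadForm_eq_sum hH, ← sum_norm_eigenCoord hH, Finset.mul_sum]
  refine Finset.sum_le_sum fun k _ => ?_
  by_cases hk : k = m
  · simp [hk, hzm]
  · exact mul_le_mul_of_nonneg_right (hge k hk) (by positivity)

end AngularSync

namespace AngularSync

variable {V : Type*} [Fintype V]

/-- The sum of `F i j` over the ordered pairs of adjacent vertices. -/
def edgeSum (G : SimpleGraph V) [DecidableRel G.Adj] (F : V → V → ℝ) : ℝ :=
  ∑ i, ∑ j, if G.Adj i j then F i j else 0

section EdgeSum

variable (G : SimpleGraph V) [DecidableRel G.Adj]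

theorem edgeSum_mono {F F' : V → V → ℝ} (h : ∀ i j, G.Adj i j → F i j ≤ F' i j) :
    edgeSum G F ≤ edgeSum G F' := by
  refine Finset.sum_le_sum fun i _ => Finset.sum_le_sum fun j _ => ?_
  split_ifs with hij
  · exact h i j hij
  · exact le_rfl

theorem edgeSum_congr {F F' : V → V → ℝ} (h : ∀ i j, G.Adj i j → F i j = F' i j) :
    edgeSum G F = edgeSum G F' :=
  le_antisymm (edgeSum_mono G fun i j hij => (h i j hij).le)
    (edgeSum_mono G fun i j hij => (h i j hij).ge)

theorem edgeSum_add (F F' : V → V → ℝ) :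
    edgeSum G (fun i j => F i j + F' i j) = edgeSum G F + edgeSum G F' := by
  simp only [edgeSum, ← Finset.sum_add_distrib]
  refine Finset.sum_congr rfl fun i _ => Finset.sum_congr rfl fun j _ => ?_
  split_ifs <;> simp

theorem edgeSum_const_mul (c : ℝ) (F : V → V → ℝ) :
    edgeSum G (fun i j => c * F i j) = c * edgeSum G F := by
  simp only [edgeSum, Finset.mul_sum, mul_ite, mul_zero]

theorem edgeSum_nonneg {F : V → V → ℝ} (h : ∀ i j, G.Adj i j → 0 ≤ F i j) : 0 ≤ edgeSum G F := by
  have := edgeSum_mono G (F := fun _ _ => 0) (F' := F) h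
  simpa [edgeSum] using this

theorem edgeSum_swap (F : V → V → ℝ) : edgeSum G (fun i j => F j i) = edgeSum G F := by
  rw [edgeSum, Finset.sum_comm]
  simp only [edgeSum, G.adj_comm]

theorem edgeSum_left (h : V → ℝ) : edgeSum G (fun i _ => h i) = ∑ i, G.degree i * h i := by
  refine Finset.sum_congr rfl fun i _ => ?_
  rw [← Finset.sum_filter, Finset.sum_const, nsmul_eq_mul, ← G.neighborFinset_eq_filter,
    G.card_neighborFinset_eq_degree]

theorem edgeSum_right (h : V → ℝ) : edgeSum G (fun _ j => h j) = ∑ i, G.degree i * h i := by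
  rw [edgeSum_swap G (fun i _ => h i), edgeSum_left]

end EdgeSum

variable (G : SimpleGraph V) [DecidableRel G.Adj]

/-- The substitution `z = D^{1/2} g`. -/
noncomputable def degSqrtMul (g : V → ℂ) : V → ℂ := fun i => (Real.sqrt (G.degree i) : ℂ) * g i

theorem norm_degSqrtMul_sq (g : V → ℂ) (i : V) :
    ‖degSqrtMul G g i‖ ^ 2 = G.degree i * ‖g i‖ ^ 2 := by
  rw [degSqrtMul, norm_mul, mul_pow, Complex.norm_real, Real.norm_eq_abs, sq_abs,
    Real.sq_sqrt (Nat.cast_nonneg _)]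

variable [DecidableEq V]

theorem degInvSqrt_mulVec_degSqrtMul (g : V → ℂ) (i : V) (hi : 0 < G.degree i) :
    (degInvSqrt G *ᵥ degSqrtMul G g) i = g i := by
  have hs : (Real.sqrt (G.degree i) : ℂ) ≠ 0 := by
    exact_mod_cast (Real.sqrt_pos.2 (by exact_mod_cast hi)).ne'
  rw [degInvSqrt, Matrix.mulVec_diagonal, degSqrtMul, Complex.ofReal_inv,
    inv_mul_cancel_left₀ hs]

theorem star_dotProduct_degMatrix_sub_mulVec_re {W : Matrix V V ℂ}
    (hW1 : ∀ i j, G.Adj i j → ‖W i j‖ = 1) (hW0 : ∀ i j, ¬ G.Adj i j → W i j = 0) (g : V → ℂ) :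
    (star g ⬝ᵥ (degMatrix G - W) *ᵥ g).re =
      edgeSum G (fun i j => ‖g i - W i j * g j‖ ^ 2) / 2 := by
  have h1 : (star g ⬝ᵥ degMatrix G *ᵥ g).re = ∑ i, G.degree i * ‖g i‖ ^ 2 := by
    rw [dotProduct, Complex.re_sum]
    refine Finset.sum_congr rfl fun i _ => ?_
    rw [degMatrix, Matrix.mulVec_diagonal, Pi.star_apply, Complex.star_def, mul_left_comm,
      Complex.conj_mul']
    norm_cast
  have h2 : (star g ⬝ᵥ W *ᵥ g).re = edgeSum G fun i j => (conj (g i) * (W i j * g j)).re := by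
    rw [dotProduct, Complex.re_sum]
    refine Finset.sum_congr rfl fun i _ => ?_
    rw [Matrix.mulVec, dotProduct, Finset.mul_sum, Complex.re_sum]
    refine Finset.sum_congr rfl fun j _ => ?_
    split_ifs with hij
    · rfl
    · simp [hW0 i j hij]
  have h3 : edgeSum G (fun i j => ‖g i - W i j * g j‖ ^ 2) =
      edgeSum G (fun i j => (‖g i‖ ^ 2 + ‖g j‖ ^ 2) +
        (-2) * (conj (g i) * (W i j * g j)).re) := by
    refine edgeSum_congr G fun i j hij => ?_
    rw [← Complex.normSq_eq_norm_sq, Complex.normSq_sub, Complex.normSq_eq_norm_sq,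
      Complex.normSq_eq_norm_sq, norm_mul, hW1 i j hij, one_mul,
      ← Complex.conj_re (g i * conj (W i j * g j)), map_mul, Complex.conj_conj]
    ring
  rw [h3, edgeSum_add, edgeSum_add, edgeSum_const_mul, edgeSum_left G fun i => ‖g i‖ ^ 2,
    edgeSum_right G fun i => ‖g i‖ ^ 2, Matrix.sub_mulVec, dotProduct_sub, Complex.sub_re, h1, h2]
  ring

theorem normalizedLaplacian_quadForm_re (hG : ∀ v, 0 < G.degree v) {W : Matrix V V ℂ}
    (hW1 : ∀ i j, G.Adj i j → ‖W i j‖ = 1) (hW0 : ∀ i j, ¬ G.Adj i j → W i j = 0) (g : V → ℂ) :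
    (star (degSqrtMul G g) ⬝ᵥ normalizedLaplacian G W *ᵥ degSqrtMul G g).re =
      edgeSum G (fun i j => ‖g i - W i j * g j‖ ^ 2) / 2 := by
  have hg : degInvSqrt G *ᵥ degSqrtMul G g = g :=
    funext fun i => degInvSqrt_mulVec_degSqrtMul G g i (hG i)
  have hs : star (degSqrtMul G g) ᵥ* degInvSqrt G = star g := by
    conv_rhs => rw [← hg]
    rw [Matrix.star_mulVec]
    congr 1
    rw [degInvSqrt, Matrix.diagonal_conjTranspose]
    congr 1
    funext v
    simp
  rw [normalizedLaplacian, ← Matrix.mulVec_mulVec, hg, ← Matrix.mulVec_mulVec,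
    Matrix.dotProduct_mulVec, hs, star_dotProduct_degMatrix_sub_mulVec_re G hW1 hW0]

theorem normalizedLaplacian_mulVec_degSqrtMul_one :
    normalizedLaplacian G (G.adjMatrix ℂ) *ᵥ degSqrtMul G 1 = 0 := by
  have h : ∀ i, (degInvSqrt G *ᵥ degSqrtMul G 1) i = if G.degree i = 0 then 0 else 1 := by
    intro i
    split_ifs with hi
    · simp [degInvSqrt, Matrix.mulVec_diagonal, hi]
    · rw [degInvSqrt_mulVec_degSqrtMul G 1 i (Nat.pos_of_ne_zero hi), Pi.one_apply]
  have h2 : (degMatrix G - G.adjMatrix ℂ) *ᵥ (degInvSqrt G *ᵥ degSqrtMul G 1) = 0 := by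
    ext i
    rw [Matrix.sub_mulVec, Pi.sub_apply, degMatrix, Matrix.mulVec_diagonal,
      SimpleGraph.adjMatrix_mulVec_apply, h, Finset.sum_congr rfl (g := fun _ => (1 : ℂ))]
    · by_cases hi : G.degree i = 0 <;> simp [hi]
    · intro j hj
      rw [h, if_neg]
      have : 0 < G.degree j := (G.degree_pos_iff_exists_adj j).2
        ⟨i, ((G.mem_neighborFinset i j).1 hj).symm⟩
      exact this.ne'
  rw [normalizedLaplacian, ← Matrix.mulVec_mulVec, ← Matrix.mulVec_mulVec, h2, Matrix.mulVec_zero]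

theorem normalizedLaplacian_mulVec_single (W : Matrix V V ℂ) {v : V} (hv : G.degree v = 0) :
    normalizedLaplacian G W *ᵥ Pi.single v 1 = 0 := by
  have h : degInvSqrt G *ᵥ Pi.single v 1 = 0 := by
    ext i
    rw [degInvSqrt, Matrix.mulVec_diagonal]
    by_cases hi : i = v
    · subst hi
      simp [hv]
    · simp [hi]
  rw [normalizedLaplacian, ← Matrix.mulVec_mulVec, h, Matrix.mulVec_zero]

variable [Nontrivial V]

theorem eq_zero_of_spectralGap_pos (hτ : 0 < spectralGap G) {v z : V → ℂ}
    (hv : normalizedLaplacian G (G.adjMatrix ℂ) *ᵥ v = 0)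
    (hz : normalizedLaplacian G (G.adjMatrix ℂ) *ᵥ z = 0) (hv0 : v ≠ 0)
    (hvz : star v ⬝ᵥ z = 0) : z = 0 := by
  have h := mul_sum_norm_le_of_orthogonal_ker
    (normalizedLaplacian_isHermitian G (adjMatrix_isHermitian G)) hτ hv hv0 hvz
  rw [hz, dotProduct_zero, Complex.zero_re] at h
  have h2 : ∑ i, ‖z i‖ ^ 2 ≤ 0 := nonpos_of_mul_nonpos_right h hτ
  ext i
  have h6 := (Finset.sum_eq_zero_iff_of_nonneg (fun i _ => by positivity)).1
    (le_antisymm h2 (Finset.sum_nonneg fun i _ => by positivity)) i (Finset.mem_univ i)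
  simpa using h6

theorem degree_pos_of_spectralGap_pos (hτ : 0 < spectralGap G) (v : V) : 0 < G.degree v := by
  by_contra! h0
  have hv : G.degree v = 0 := Nat.le_zero.1 h0
  have hne : (Pi.single v 1 : V → ℂ) ≠ 0 := by simp
  have h1 : degSqrtMul G 1 = 0 := by
    refine eq_zero_of_spectralGap_pos G hτ (normalizedLaplacian_mulVec_single G _ hv)
      (normalizedLaplacian_mulVec_degSqrtMul_one G) hne ?_
    rw [← Pi.single_star, single_dotProduct, degSqrtMul, hv]
    simp
  obtain ⟨w, hw⟩ := exists_ne v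
  have hdw : G.degree w = 0 := by
    have h2 := norm_degSqrtMul_sq G 1 w
    rw [h1] at h2
    simpa using h2.symm
  have h3 := eq_zero_of_spectralGap_pos G hτ (normalizedLaplacian_mulVec_single G _ hv)
    (normalizedLaplacian_mulVec_single G _ hdw) hne (by
      rw [← Pi.single_star, single_dotProduct]
      simp [hw.symm])
  simpa using congrFun h3 w

/-- The Poincaré inequality for the degree-weighted mean. -/
theorem spectralGap_mul_le_edgeSum (hτ : 0 < spectralGap G) (g : V → ℂ) {c : ℂ}
    (hc : ∑ i, (G.degree i : ℂ) * (g i - c) = 0) :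
    2 * spectralGap G * ∑ i, G.degree i * ‖g i - c‖ ^ 2 ≤
      edgeSum G fun i j => ‖g i - g j‖ ^ 2 := by
  have hd := degree_pos_of_spectralGap_pos G hτ
  have hne : degSqrtMul G 1 ≠ 0 := by
    intro h
    obtain ⟨v⟩ : Nonempty V := inferInstance
    have h2 := norm_degSqrtMul_sq G 1 v
    rw [h] at h2
    simp only [Pi.zero_apply, norm_zero, Pi.one_apply, norm_one, one_pow, mul_one] at h2
    rw [zero_pow two_ne_zero] at h2
    exact (hd v).ne (by exact_mod_cast h2)
  have h := mul_sum_norm_le_of_orthogonal_ker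
    (normalizedLaplacian_isHermitian G (adjMatrix_isHermitian G)) hτ
    (normalizedLaplacian_mulVec_degSqrtMul_one G) hne (z := degSqrtMul G fun i => g i - c) (by
      rw [← hc, dotProduct]
      refine Finset.sum_congr rfl fun i _ => ?_
      have hs : (Real.sqrt (G.degree i) : ℂ) * Real.sqrt (G.degree i) = G.degree i := by
        exact_mod_cast Real.mul_self_sqrt (Nat.cast_nonneg (G.degree i))
      simp only [degSqrtMul, Pi.star_apply, Pi.one_apply, mul_one, Complex.star_def,
        Complex.conj_ofReal]
      rw [← mul_assoc, hs])
  rw [normalizedLaplacian_quadForm_re G hd (by simp +contextual) (by simp +contextual)] at h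
  simp only [norm_degSqrtMul_sq] at h
  change spectralGap G * _ ≤ _ at h
  rw [edgeSum_congr G (F' := fun i j => ‖g i - g j‖ ^ 2)] at h
  · linarith
  · intro i j hij
    rw [SimpleGraph.adjMatrix_apply, if_pos hij, one_mul, sub_sub_sub_cancel_right]

theorem spectralGap_le_two (hτ : 0 < spectralGap G) : spectralGap G ≤ 2 := by
  have hd := degree_pos_of_spectralGap_pos G hτ
  set hH := normalizedLaplacian_isHermitian G (adjMatrix_isHermitian G)
  obtain ⟨k, hk⟩ : ∃ k, hH.eigenvalues k = spectralGap G := by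
    refine ⟨Fintype.equivOfCardEq (Fintype.card_fin _)
      ⟨Fintype.card V - 2, Nat.sub_lt Fintype.card_pos two_pos⟩, ?_⟩
    rw [Matrix.IsHermitian.eigenvalues, Equiv.symm_apply_apply]
    rfl
  obtain ⟨z, hz⟩ := (hasEigenvalue_eigenvalues hH k).exists_hasEigenvector
  have hz1 := hz.apply_eq_smul
  rw [Matrix.toLin'_apply, hk] at hz1
  have hzg : degSqrtMul G (fun i => (Real.sqrt (G.degree i) : ℂ)⁻¹ * z i) = z := by
    ext i
    have hs : (Real.sqrt (G.degree i) : ℂ) ≠ 0 := by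
      exact_mod_cast (Real.sqrt_pos.2 (by exact_mod_cast hd i)).ne'
    rw [degSqrtMul, mul_inv_cancel_left₀ hs]
  set g : V → ℂ := fun i => (Real.sqrt (G.degree i) : ℂ)⁻¹ * z i
  have hq := normalizedLaplacian_quadForm_re G hd (W := G.adjMatrix ℂ)
    (by simp +contextual) (by simp +contextual) g
  rw [hzg, hz1, dotProduct_smul, smul_eq_mul, Complex.re_ofReal_mul, star_dotProduct_self_re,
    ← hzg] at hq
  simp only [norm_degSqrtMul_sq] at hq
  have hle : edgeSum G (fun i j => ‖g i - G.adjMatrix ℂ i j * g j‖ ^ 2) ≤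
      edgeSum G (fun i j => 2 * (‖g i‖ ^ 2 + ‖g j‖ ^ 2)) := by
    refine edgeSum_mono G fun i j hij => ?_
    rw [SimpleGraph.adjMatrix_apply, if_pos hij, one_mul]
    have := norm_sub_le (g i) (g j)
    nlinarith [norm_nonneg (g i - g j), sq_nonneg (‖g i‖ - ‖g j‖)]
  rw [edgeSum_const_mul, edgeSum_add, edgeSum_left G fun i => ‖g i‖ ^ 2,
    edgeSum_right G fun i => ‖g i‖ ^ 2] at hle
  have hpos : 0 < ∑ i, G.degree i * ‖g i‖ ^ 2 := by
    simp only [← norm_degSqrtMul_sq, hzg]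
    obtain ⟨i, hi⟩ := Function.ne_iff.1 hz.2
    refine Finset.sum_pos' (fun i _ => by positivity) ⟨i, Finset.mem_univ i, ?_⟩
    have := norm_pos_iff.2 hi
    positivity
  refine le_of_mul_le_mul_right ?_ hpos
  linarith

end AngularSync

namespace AngularSync

theorem norm_coe_arg_sub_sub_le {u w p : ℂ} (hu : ‖u‖ = 1) (hw : ‖w‖ = 1) (hp : ‖p‖ = 1) :
    ‖(u.arg : Real.Angle) - (w.arg : Real.Angle) - (p.arg : Real.Angle)‖ ≤
      Real.pi / 2 * ‖conj w * u - p‖ := by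
  have hu0 : u ≠ 0 := norm_ne_zero_iff.1 (by simp [hu])
  have hw0 : w ≠ 0 := norm_ne_zero_iff.1 (by simp [hw])
  have hp0 : p ≠ 0 := norm_ne_zero_iff.1 (by simp [hp])
  rw [← Complex.arg_div_coe_angle hu0 hw0, ← Complex.arg_div_coe_angle (div_ne_zero hu0 hw0) hp0]
  have h1 : ‖((u / w / p).arg : Real.Angle)‖ = |(u / w / p).arg| := by
    refine (AddCircle.norm_coe_eq_abs_iff (2 * Real.pi) Real.two_pi_pos.ne').2 ?_
    rw [abs_of_pos Real.two_pi_pos, mul_div_cancel_left₀ _ two_ne_zero]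
    exact Complex.abs_arg_le_pi _
  have h2 : u / w = conj w * u := by
    rw [div_eq_mul_inv, Complex.inv_eq_conj hw, mul_comm]
  rw [h1, ← Complex.angle_eq_abs_arg (div_ne_zero hu0 hw0) hp0, h2]
  exact Complex.angle_le_mul_norm_sub (by rw [norm_mul, RCLike.norm_conj, hw, hu, mul_one]) hp

/-- Some number of modulus one is at least half as good an approximation of unit-modulus numbers
as `c`. -/
theorem exists_norm_eq_one_norm_sub_le (c : ℂ) :
    ∃ p : ℂ, ‖p‖ = 1 ∧ ∀ v : ℂ, ‖v‖ = 1 → ‖v - p‖ ≤ 2 * ‖v - c‖ := by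
  by_cases hc : c = 0
  · refine ⟨1, norm_one, fun v hv => ?_⟩
    have := norm_sub_le v 1
    rw [hc, sub_zero, hv]
    rw [hv, norm_one] at this
    linarith
  · have hc' : ‖c‖ ≠ 0 := norm_ne_zero_iff.2 hc
    have hp : ‖c / ‖c‖‖ = 1 := by simp [hc']
    refine ⟨c / ‖c‖, hp, fun v hv => ?_⟩
    have h1 : ‖c - c / ‖c‖‖ = |‖c‖ - 1| := by
      have : c - c / ‖c‖ = ((‖c‖ - 1 : ℝ) : ℂ) * (c / ‖c‖) := by
        have : (‖c‖ : ℂ) ≠ 0 := by exact_mod_cast hc'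
        push_cast
        field_simp
      rw [this, norm_mul, hp, mul_one, Complex.norm_real, Real.norm_eq_abs]
    have h2 := abs_norm_sub_norm_le c v
    rw [hv, norm_sub_rev] at h2
    have h3 := norm_sub_le_norm_sub_add_norm_sub v c (c / ‖c‖)
    linarith

theorem norm_div_norm_sub_le {z a w : ℂ} (hz : z ≠ 0) (hw : ‖w‖ = 1) (ha : a = (‖a‖ : ℂ) * w) :
    ‖z / ‖z‖ - w‖ * ‖z‖ ≤ 2 * ‖z - a‖ := by
  have hz' : (‖z‖ : ℂ) ≠ 0 := by exact_mod_cast norm_ne_zero_iff.2 hz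
  have h1 : ‖z / ‖z‖ - w‖ * ‖z‖ = ‖z - ‖z‖ * w‖ := by
    have h0 : z - ‖z‖ * w = (z / ‖z‖ - w) * (‖z‖ : ℂ) := by
      rw [sub_mul, div_mul_cancel₀ _ hz', mul_comm w]
    rw [h0, norm_mul, Complex.norm_real, norm_norm]
  have h2 : ‖a - ‖z‖ * w‖ = |‖a‖ - ‖z‖| := by
    nth_rewrite 1 [ha]
    rw [← sub_mul, ← Complex.ofReal_sub, norm_mul, hw, mul_one, Complex.norm_real,
      Real.norm_eq_abs]
  have h3 := abs_norm_sub_norm_le a z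
  rw [norm_sub_rev] at h3
  have h4 := norm_sub_le_norm_sub_add_norm_sub z a (‖z‖ * w)
  linarith

variable {V : Type*} [Fintype V]
variable (G : SimpleGraph V) [DecidableRel G.Adj]

theorem sum_degree_mul_sub_mean (hd : 0 < ∑ i, (G.degree i : ℝ)) (g : V → ℂ) :
    ∑ i, (G.degree i : ℂ) * (g i - (∑ j, G.degree j * g j) / ∑ j, (G.degree j : ℂ)) = 0 := by
  have h : ∑ j, (G.degree j : ℂ) ≠ 0 := by exact_mod_cast hd.ne'
  simp only [mul_sub, Finset.sum_sub_distrib, ← Finset.sum_mul]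
  rw [mul_div_cancel₀ _ h, sub_self]

variable {G} [DecidableEq V] [Nontrivial V]

/-- The edgewise frustration of the phases `u` of `g` is controlled by that of `ω`, when the
frustration of `g` is at most that of `ω` relative to the weighted norms. -/
theorem edgeSum_phase_le (hτ : 0 < spectralGap G) {B : Matrix V V ℂ}
    (hB : ∀ i j, G.Adj i j → ‖B i j‖ = 1) {g u : V → ℂ} {S : ℝ}
    (hu : ∀ i, ‖u i‖ = 1) (hg : ∀ i, g i = (‖g i‖ : ℂ) * u i)
    (hN : 0 < ∑ i, G.degree i * ‖g i‖ ^ 2)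
    (hQ : edgeSum G (fun i j => ‖g i - B i j * g j‖ ^ 2) * ∑ i, (G.degree i : ℝ) ≤
      (∑ i, G.degree i * ‖g i‖ ^ 2) * S) :
    edgeSum G (fun i j => ‖u i - B i j * u j‖ ^ 2) ≤ S * (8 + 6 / spectralGap G) := by
  have hd := degree_pos_of_spectralGap_pos G hτ
  set τ := spectralGap G
  set N := ∑ i, G.degree i * ‖g i‖ ^ 2 with hNdef
  set vol := ∑ i, (G.degree i : ℝ) with hvol
  set Q := edgeSum G (fun i j => ‖g i - B i j * g j‖ ^ 2) with hQdef
  set X := edgeSum G (fun i j => ‖u i - B i j * u j‖ ^ 2) with hXdef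
  have hvol0 : 0 < vol := Finset.sum_pos (fun i _ => by exact_mod_cast hd i) Finset.univ_nonempty
  set t : ℝ := (∑ j, G.degree j * ‖g j‖) / vol
  have htv : t * vol = ∑ j, G.degree j * ‖g j‖ := div_mul_cancel₀ _ hvol0.ne'
  have hdiff : ∀ i j, G.Adj i j → |‖g i‖ - ‖g j‖| ≤ ‖g i - B i j * g j‖ := by
    intro i j hij
    have := abs_norm_sub_norm_le (g i) (B i j * g j)
    rwa [norm_mul, hB i j hij, one_mul] at this
  have hvar : ∑ i, G.degree i * (‖g i‖ - t) ^ 2 = N - t ^ 2 * vol := by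
    have : ∀ i, (G.degree i : ℝ) * (‖g i‖ - t) ^ 2 =
      G.degree i * ‖g i‖ ^ 2 - 2 * t * (G.degree i * ‖g i‖) + t ^ 2 * G.degree i := fun i => by ring
    simp only [this, Finset.sum_add_distrib, Finset.sum_sub_distrib, ← Finset.mul_sum]
    rw [← hNdef, ← hvol, ← htv]
    ring
  have hpoin : 2 * τ * (N - t ^ 2 * vol) ≤ Q := by
    have h := spectralGap_mul_le_edgeSum G hτ (fun i => (‖g i‖ : ℂ)) (c := (t : ℂ)) (by
      have : ∑ i, (G.degree i : ℝ) * (‖g i‖ - t) = 0 := by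
        simp only [mul_sub, Finset.sum_sub_distrib, ← Finset.sum_mul]
        rw [← hvol, ← htv]
        ring
      exact_mod_cast this)
    simp only [← Complex.ofReal_sub, Complex.norm_real, Real.norm_eq_abs, sq_abs] at h
    rw [hvar] at h
    refine h.trans (edgeSum_mono G fun i j hij => ?_)
    rw [← sq_abs]
    have := hdiff i j hij
    gcongr
  have htX : t ^ 2 * X ≤ 8 * Q + 8 * (N - t ^ 2 * vol) := by
    rw [← hvar, ← edgeSum_left G fun i => (‖g i‖ - t) ^ 2, hXdef, hQdef, ← edgeSum_const_mul,
      ← edgeSum_const_mul, ← edgeSum_const_mul, ← edgeSum_add]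
    refine edgeSum_mono G fun i j hij => ?_
    set a := ‖u i - B i j * u j‖
    have ha2 : a ≤ 2 := by
      have := norm_sub_le (u i) (B i j * u j)
      rw [norm_mul, hB i j hij, hu, hu] at this
      linarith
    have ha0 : 0 ≤ a := norm_nonneg _
    have h1 : ‖g i‖ * a ≤ 2 * ‖g i - B i j * g j‖ := by
      have h2 : (‖g i‖ : ℂ) * (u i - B i j * u j) =
          (g i - B i j * g j) + ((‖g j‖ - ‖g i‖ : ℝ) : ℂ) * (B i j * u j) := by
        push_cast
        linear_combination B i j * hg j - hg i
      have h3 : ‖g i‖ * a = ‖(‖g i‖ : ℂ) * (u i - B i j * u j)‖ := by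
        rw [norm_mul, Complex.norm_real, norm_norm]
      rw [h3, h2]
      refine (norm_add_le _ _).trans ?_
      rw [norm_mul, norm_mul, hB i j hij, hu, Complex.norm_real, Real.norm_eq_abs, abs_sub_comm]
      linarith [hdiff i j hij]
    have h4 : |t * a| ≤ 2 * ‖g i - B i j * g j‖ + 2 * |‖g i‖ - t| := by
      have h5 : t * a = ‖g i‖ * a - (‖g i‖ - t) * a := by ring
      rw [h5]
      refine (abs_sub _ _).trans ?_
      rw [abs_of_nonneg (by positivity : 0 ≤ ‖g i‖ * a), abs_mul, abs_of_nonneg ha0]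
      nlinarith [abs_nonneg (‖g i‖ - t)]
    rw [← mul_pow, ← sq_abs (t * a), ← sq_abs (‖g i‖ - t)]
    nlinarith [abs_nonneg (t * a), sq_nonneg (‖g i - B i j * g j‖ - |‖g i‖ - t|)]
  have hX4 : X ≤ 4 * vol := by
    have h : edgeSum G (fun _ _ => (4 : ℝ)) = 4 * vol := by
      rw [edgeSum_left G fun _ => (4 : ℝ), ← Finset.sum_mul, mul_comm]
    rw [← h]
    refine edgeSum_mono G fun i j hij => ?_
    have := norm_sub_le (u i) (B i j * u j)
    rw [norm_mul, hB i j hij, hu, hu] at this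
    nlinarith [norm_nonneg (u i - B i j * u j)]
  have hR : N - t ^ 2 * vol ≤ Q / (2 * τ) := by
    rw [le_div_iff₀ (by positivity)]
    linarith
  have hR0 : 0 ≤ N - t ^ 2 * vol := by
    rw [← hvar]
    exact Finset.sum_nonneg fun i _ => by positivity
  have hmain : X * N ≤ S * (8 + 6 / τ) * N := by
    calc X * N = t ^ 2 * X * vol + X * (N - t ^ 2 * vol) := by ring
      _ ≤ (8 * Q + 8 * (N - t ^ 2 * vol)) * vol + 4 * vol * (N - t ^ 2 * vol) := by gcongr
      _ = 8 * (Q * vol) + 12 * vol * (N - t ^ 2 * vol) := by ring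
      _ ≤ 8 * (Q * vol) + 12 * vol * (Q / (2 * τ)) := by gcongr
      _ = Q * vol * (8 + 6 / τ) := by ring
      _ ≤ N * S * (8 + 6 / τ) := by gcongr
      _ = S * (8 + 6 / τ) * N := by ring
  exact le_of_mul_le_mul_right hmain hN

/-- The phases `u` of `g` agree with `ω` up to a global phase. -/
theorem exists_phase_sum_le (hτ : 0 < spectralGap G) {B : Matrix V V ℂ}
    (hB : ∀ i j, G.Adj i j → ‖B i j‖ = 1) {g u ω : V → ℂ}
    (hu : ∀ i, ‖u i‖ = 1) (hω : ∀ i, ‖ω i‖ = 1) (hg : ∀ i, g i = (‖g i‖ : ℂ) * u i)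
    (hN : 0 < ∑ i, G.degree i * ‖g i‖ ^ 2)
    (hQ : edgeSum G (fun i j => ‖g i - B i j * g j‖ ^ 2) * ∑ i, (G.degree i : ℝ) ≤
      (∑ i, G.degree i * ‖g i‖ ^ 2) * edgeSum G (fun i j => ‖ω i - B i j * ω j‖ ^ 2)) :
    ∃ p : ℂ, ‖p‖ = 1 ∧ ∑ i, ‖conj (ω i) * u i - p‖ ^ 2 ≤
      96 * edgeSum G (fun i j => ‖ω i - B i j * ω j‖ ^ 2) / spectralGap G ^ 2 := by
  have hd := degree_pos_of_spectralGap_pos G hτ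
  have hτ2 := spectralGap_le_two G hτ
  have hX := edgeSum_phase_le hτ hB hu hg hN hQ
  set S := edgeSum G (fun i j => ‖ω i - B i j * ω j‖ ^ 2) with hS
  have hS0 : 0 ≤ S := edgeSum_nonneg G fun _ _ _ => by positivity
  have hvol : 0 < ∑ i, (G.degree i : ℝ) :=
    Finset.sum_pos (fun i _ => by exact_mod_cast hd i) Finset.univ_nonempty
  have hY : edgeSum G (fun i j => ‖conj (ω i) * u i - conj (ω j) * u j‖ ^ 2) ≤
      2 * edgeSum G (fun i j => ‖u i - B i j * u j‖ ^ 2) + 2 * S := by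
    rw [hS, ← edgeSum_const_mul, ← edgeSum_const_mul, ← edgeSum_add]
    refine edgeSum_mono G fun i j _ => ?_
    have hcancel : ∀ k, conj (ω k) * ω k = 1 := fun k => by rw [Complex.conj_mul', hω]; norm_num
    have h1 : conj (ω i) * u i - conj (ω j) * u j = conj (ω i) * (u i - B i j * u j) -
        conj (ω i) * (ω i - B i j * ω j) * (conj (ω j) * u j) := by
      linear_combination (conj (ω j) * u j) * hcancel i -
        conj (ω i) * B i j * u j * hcancel j
    have h2 : ‖conj (ω i) * u i - conj (ω j) * u j‖ ≤
        ‖u i - B i j * u j‖ + ‖ω i - B i j * ω j‖ := by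
      rw [h1]
      refine (norm_sub_le _ _).trans ?_
      simp only [norm_mul, RCLike.norm_conj, hω, hu, one_mul, mul_one, le_refl]
    calc _ ≤ (‖u i - B i j * u j‖ + ‖ω i - B i j * ω j‖) ^ 2 := by gcongr
      _ ≤ _ := by nlinarith [sq_nonneg (‖u i - B i j * u j‖ - ‖ω i - B i j * ω j‖)]
  have hP := spectralGap_mul_le_edgeSum G hτ (fun i => conj (ω i) * u i)
    (sum_degree_mul_sub_mean G hvol _)
  obtain ⟨p, hp, hpv⟩ := exists_norm_eq_one_norm_sub_le
    ((∑ j, G.degree j * (conj (ω j) * u j)) / ∑ j, (G.degree j : ℂ))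
  set c := (∑ j, G.degree j * (conj (ω j) * u j)) / ∑ j, (G.degree j : ℂ)
  set τ := spectralGap G
  refine ⟨p, hp, ?_⟩
  have h1 : ∑ i, ‖conj (ω i) * u i - p‖ ^ 2 ≤
      4 * ∑ i, G.degree i * ‖conj (ω i) * u i - c‖ ^ 2 := by
    rw [Finset.mul_sum]
    refine Finset.sum_le_sum fun i _ => ?_
    have h2 := hpv (conj (ω i) * u i) (by rw [norm_mul, RCLike.norm_conj, hω, hu, one_mul])
    have h3 : (1 : ℝ) ≤ G.degree i := by exact_mod_cast hd i
    calc _ ≤ (2 * ‖conj (ω i) * u i - c‖) ^ 2 := by gcongr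
      _ = 4 * (1 * ‖conj (ω i) * u i - c‖ ^ 2) := by ring
      _ ≤ _ := by gcongr
  refine h1.trans ?_
  rw [le_div_iff₀ (by positivity)]
  have h4 : S * (8 + 6 / τ) * τ = S * (8 * τ + 6) := by field_simp
  have h5 := mul_le_mul_of_nonneg_right hX hτ.le
  have h6 := mul_le_mul_of_nonneg_right (hP.trans hY) hτ.le
  have h7 : S * τ ≤ S * 2 := mul_le_mul_of_nonneg_left hτ2 hS0
  nlinarith

end AngularSync

namespace AngularSync

variable {V : Type*} {G : SimpleGraph V} [DecidableRel G.Adj]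

section Measurements

variable {M : ℕ} {x : EuclideanSpace ℂ (Fin M)} {φ : V → EuclideanSpace ℂ (Fin M)}
  {ε : V → V → ℂ}

theorem norm_weightedAdj (hne : ∀ i j, G.Adj i j → noisyProduct x φ ε i j ≠ 0) {i j : V}
    (hij : G.Adj i j) : ‖weightedAdj G x φ ε i j‖ = 1 := by
  simp [weightedAdj, hij, hne i j hij]

theorem weightedAdj_of_not_adj {i j : V} (hij : ¬ G.Adj i j) : weightedAdj G x φ ε i j = 0 := by
  simp [weightedAdj, hij]

theorem weightedAdj_isHermitian (hε : ∀ i j, G.Adj i j → ε j i = conj (ε i j)) :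
    (weightedAdj G x φ ε).IsHermitian := by
  ext i j
  by_cases hij : G.Adj i j
  · have h : noisyProduct x φ ε j i = conj (noisyProduct x φ ε i j) := by
      simp only [noisyProduct, map_add, map_mul, Complex.conj_conj, hε i j hij]
      ring
    simp [weightedAdj, hij, hij.symm, h]
  · rw [Matrix.conjTranspose_apply, weightedAdj_of_not_adj hij,
      weightedAdj_of_not_adj fun h => hij h.symm, star_zero]

variable (x φ) in
/-- The phase of the measurement `⟨x, φᵢ⟩`, equal to `1` if the measurement vanishes. -/
noncomputable def measurementPhase (i : V) : ℂ := Complex.exp ((ip x (φ i)).arg * Complex.I)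

theorem norm_measurementPhase (i : V) : ‖measurementPhase x φ i‖ = 1 :=
  Complex.norm_exp_ofReal_mul_I _

theorem arg_measurementPhase (i : V) : (measurementPhase x φ i).arg = (ip x (φ i)).arg := by
  rw [measurementPhase, Complex.arg_exp_mul_I, toIocMod_eq_self,
    show -Real.pi + 2 * Real.pi = Real.pi by ring]
  exact Complex.arg_mem_Ioc _

theorem norm_measurementPhase_sub_mul (hne : ∀ i j, G.Adj i j → noisyProduct x φ ε i j ≠ 0)
    {i j : V} (hij : G.Adj i j) :
    ‖measurementPhase x φ j - weightedAdj G x φ ε i j * measurementPhase x φ i‖ *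
      ‖noisyProduct x φ ε i j‖ ≤ 2 * ‖ε i j‖ := by
  set ω := measurementPhase x φ with hω
  have h1 : ∀ k, ip x (φ k) = (‖ip x (φ k)‖ : ℂ) * ω k := fun k =>
    (Complex.norm_mul_exp_arg_mul_I _).symm
  have hn : ∀ k, ‖ω k‖ = 1 := norm_measurementPhase
  have h2 := norm_div_norm_sub_le (hne i j hij) (w := conj (ω i) * ω j)
    (a := conj (ip x (φ i)) * ip x (φ j))
    (by rw [norm_mul, RCLike.norm_conj, hn, hn, one_mul]) (by
      rw [norm_mul, RCLike.norm_conj]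
      nth_rewrite 1 [h1 i]
      nth_rewrite 1 [h1 j]
      rw [map_mul, Complex.conj_ofReal]
      push_cast
      ring)
  have h3 : noisyProduct x φ ε i j - conj (ip x (φ i)) * ip x (φ j) = ε i j := by
    rw [noisyProduct, add_sub_cancel_left]
  rw [h3] at h2
  refine le_trans (le_of_eq ?_) h2
  congr 1
  have h4 : weightedAdj G x φ ε i j =
      noisyProduct x φ ε i j / ‖noisyProduct x φ ε i j‖ := by simp [weightedAdj, hij]
  have h5 : conj (ω i) * ω i = 1 := by rw [Complex.conj_mul', hn]; norm_num
  have h6 : ω j - weightedAdj G x φ ε i j * ω i =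
      ω i * (conj (ω i) * ω j - weightedAdj G x φ ε i j) := by
    linear_combination -ω j * h5
  rw [h6, norm_mul, hn, one_mul, norm_sub_rev, h4]

variable [Fintype V]

theorem minEdgeModulus_le {i j : V} (hij : G.Adj i j) :
    minEdgeModulus G x φ ε ≤ ‖noisyProduct x φ ε i j‖ :=
  ciInf_le (f := fun d : G.Dart => ‖noisyProduct x φ ε d.fst d.snd‖)
    (Set.finite_range _).bddBelow ⟨(i, j), hij⟩

theorem minEdgeModulus_pos [Nonempty G.Dart]
    (hne : ∀ i j, G.Adj i j → noisyProduct x φ ε i j ≠ 0) : 0 < minEdgeModulus G x φ ε := by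
  obtain ⟨d, hd⟩ := exists_eq_ciInf_of_finite
    (f := fun d : G.Dart => ‖noisyProduct x φ ε d.fst d.snd‖)
  rw [minEdgeModulus, ← hd]
  exact norm_pos_iff.2 (hne _ _ d.adj)

theorem edgeSum_measurementPhase_le (hP : 0 < minEdgeModulus G x φ ε)
    (hne : ∀ i j, G.Adj i j → noisyProduct x φ ε i j ≠ 0) :
    edgeSum G (fun i j => ‖measurementPhase x φ i -
      (weightedAdj G x φ ε)ᵀ i j * measurementPhase x φ j‖ ^ 2) ≤
      8 * noiseNormSq G ε / minEdgeModulus G x φ ε ^ 2 := by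
  set P := minEdgeModulus G x φ ε
  have h : 8 * noiseNormSq G ε / P ^ 2 = edgeSum G fun i j => 4 / P ^ 2 * ‖ε j i‖ ^ 2 := by
    rw [edgeSum_const_mul, edgeSum_swap G fun i j => ‖ε i j‖ ^ 2, noiseNormSq, edgeSum]
    ring
  rw [h]
  refine edgeSum_mono G fun i j hij => ?_
  rw [Matrix.transpose_apply, div_mul_eq_mul_div, le_div_iff₀ (by positivity)]
  have h1 := norm_measurementPhase_sub_mul hne hij.symm
  have h2 : P ≤ ‖noisyProduct x φ ε j i‖ := minEdgeModulus_le hij.symm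
  calc _ = (‖measurementPhase x φ i - weightedAdj G x φ ε j i * measurementPhase x φ j‖ * P) ^ 2 :=
        by ring
    _ ≤ (2 * ‖ε j i‖) ^ 2 := by
        refine pow_le_pow_left₀ (by positivity) (le_trans ?_ h1) 2
        gcongr
    _ = _ := by ring

variable [DecidableEq V]

theorem connectionLaplacian_isHermitian (hε : ∀ i j, G.Adj i j → ε j i = conj (ε i j)) :
    (connectionLaplacian G (weightedAdj G x φ ε)).IsHermitian :=
  normalizedLaplacian_isHermitian G (weightedAdj_isHermitian hε).transpose

theorem exists_isAngularSyncOutput [Nonempty V]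
    (hε : ∀ i j, G.Adj i j → ε j i = conj (ε i j)) :
    ∃ u : V → ℂ, IsAngularSyncOutput G (weightedAdj G x φ ε) u := by
  obtain ⟨μ, hμ⟩ := exists_isLeast_hasEigenvalue
    (connectionLaplacian_isHermitian (x := x) (φ := φ) hε)
  obtain ⟨f, hf⟩ := Module.End.HasEigenvalue.exists_hasEigenvector hμ.1
  refine ⟨fun i => if f i = 0 then 1 else f i / ‖f i‖, μ, f, hμ, hf, fun i => ?_⟩
  by_cases h : f i = 0
  · simp [h]
  · have h' : (‖f i‖ : ℂ) ≠ 0 := by exact_mod_cast norm_ne_zero_iff.2 h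
    simp only [h, if_false]
    exact ⟨by simp [h], (mul_div_cancel₀ _ h').symm⟩

theorem IsAngularSyncOutput.exists_phase [Nontrivial V] (hτ : 0 < spectralGap G)
    (hε : ∀ i j, G.Adj i j → ε j i = conj (ε i j))
    (hne : ∀ i j, G.Adj i j → noisyProduct x φ ε i j ≠ 0) {u : V → ℂ}
    (hu : IsAngularSyncOutput G (weightedAdj G x φ ε) u) :
    ∃ p : ℂ, ‖p‖ = 1 ∧ ∑ i, ‖conj (measurementPhase x φ i) * u i - p‖ ^ 2 ≤
      96 * edgeSum G (fun i j => ‖measurementPhase x φ i -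
        (weightedAdj G x φ ε)ᵀ i j * measurementPhase x φ j‖ ^ 2) / spectralGap G ^ 2 := by
  obtain ⟨μ, f, hμ, hf, hfu⟩ := hu
  have hd := degree_pos_of_spectralGap_pos G hτ
  set B := (weightedAdj G x φ ε)ᵀ
  set ω := measurementPhase x φ with hω
  have hB1 : ∀ i j, G.Adj i j → ‖B i j‖ = 1 := fun i j hij => norm_weightedAdj hne hij.symm
  have hB0 : ∀ i j, ¬ G.Adj i j → B i j = 0 := fun i j hij =>
    weightedAdj_of_not_adj fun h => hij h.symm
  have hωn : ∀ i, ‖ω i‖ = 1 := norm_measurementPhase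
  obtain ⟨g, hg⟩ : ∃ g : V → ℂ, ∀ i, g i = (((Real.sqrt (G.degree i))⁻¹ : ℝ) : ℂ) * f i :=
    ⟨_, fun _ => rfl⟩
  have hgf : degSqrtMul G g = f := by
    ext i
    have hs : (Real.sqrt (G.degree i) : ℂ) ≠ 0 := by
      exact_mod_cast (Real.sqrt_pos.2 (by exact_mod_cast hd i)).ne'
    rw [degSqrtMul, hg, Complex.ofReal_inv, mul_inv_cancel_left₀ hs]
  have hgu : ∀ i, g i = (‖g i‖ : ℂ) * u i := by
    intro i
    have h : ‖g i‖ = (Real.sqrt (G.degree i))⁻¹ * ‖f i‖ := by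
      rw [hg, norm_mul, Complex.norm_real, Real.norm_of_nonneg (by positivity)]
    rw [h, Complex.ofReal_mul, mul_assoc, ← (hfu i).2, hg]
  have hN : ∑ i, G.degree i * ‖g i‖ ^ 2 = ∑ i, ‖f i‖ ^ 2 := by
    simp only [← norm_degSqrtMul_sq, hgf]
  have hN0 : 0 < ∑ i, ‖f i‖ ^ 2 := by
    obtain ⟨i, hi⟩ := Function.ne_iff.1 hf.2
    refine Finset.sum_pos' (fun i _ => by positivity) ⟨i, Finset.mem_univ i, ?_⟩
    have := norm_pos_iff.2 hi
    positivity
  have hQ : μ * ∑ i, ‖f i‖ ^ 2 = edgeSum G (fun i j => ‖g i - B i j * g j‖ ^ 2) / 2 := by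
    have h1 := hf.apply_eq_smul
    rw [Matrix.toLin'_apply, connectionLaplacian] at h1
    rw [← normalizedLaplacian_quadForm_re G hd hB1 hB0, hgf, h1, dotProduct_smul, smul_eq_mul,
      Complex.re_ofReal_mul, star_dotProduct_self_re]
  have hS := mul_sum_norm_le_re_quadForm (connectionLaplacian_isHermitian hε) hμ (degSqrtMul G ω)
  rw [connectionLaplacian, normalizedLaplacian_quadForm_re G hd hB1 hB0] at hS
  simp only [norm_degSqrtMul_sq, hωn, one_pow, mul_one] at hS
  refine exists_phase_sum_le hτ hB1 (fun i => (hfu i).1) hωn hgu (hN ▸ hN0) ?_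
  rw [hN]
  have := mul_le_mul_of_nonneg_left hS hN0.le
  linear_combination 2 * this + 2 * (∑ i, (G.degree i : ℝ)) * -hQ

end Measurements

end AngularSync

theorem mainTheorem3 :
    ∃ C : ℝ, 0 < C ∧
      ∀ (V : Type*) [Fintype V] [DecidableEq V] [Nontrivial V]
        (G : SimpleGraph V) [DecidableRel G.Adj],
        0 < AngularSync.spectralGap G →
        ∀ (M : ℕ) (x : EuclideanSpace ℂ (Fin M)) (φ : V → EuclideanSpace ℂ (Fin M))
          (ε : V → V → ℂ),
          (∀ i j, G.Adj i j → ε j i = (starRingEnd ℂ) (ε i j)) →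
          (∀ i j, G.Adj i j → AngularSync.noisyProduct x φ ε i j ≠ 0) →
          (∃ u : V → ℂ,
            AngularSync.IsAngularSyncOutput G (AngularSync.weightedAdj G x φ ε) u) ∧
          ∀ u : V → ℂ,
            AngularSync.IsAngularSyncOutput G (AngularSync.weightedAdj G x φ ε) u →
            ∃ θ : Real.Angle,
              ∑ i, ‖((u i).arg : Real.Angle) - ((AngularSync.ip x (φ i)).arg : Real.Angle) - θ‖ ^ 2
                ≤ C * AngularSync.noiseNormSq G ε /
                    (AngularSync.spectralGap G ^ 2 *
                      AngularSync.minEdgeModulus G x φ ε ^ 2) := by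
  refine ⟨3072, by norm_num, ?_⟩
  intro V _ _ _ G _ hτ M x φ ε hε hne
  refine ⟨AngularSync.exists_isAngularSyncOutput hε, fun u hu => ?_⟩
  obtain ⟨p, hp, hsum⟩ := hu.exists_phase hτ hε hne
  have : Nonempty G.Dart := by
    obtain ⟨v⟩ : Nonempty V := inferInstance
    obtain ⟨w, hw⟩ := (G.degree_pos_iff_exists_adj v).1
      (AngularSync.degree_pos_of_spectralGap_pos G hτ v)
    exact ⟨⟨(v, w), hw⟩⟩
  have hP := AngularSync.minEdgeModulus_pos (x := x) (φ := φ) (ε := ε) hne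
  have hS := AngularSync.edgeSum_measurementPhase_le hP hne
  obtain ⟨_, _, _, _, hphase⟩ := hu
  refine ⟨(p.arg : Real.Angle), ?_⟩
  calc ∑ i, ‖((u i).arg : Real.Angle) - ((AngularSync.ip x (φ i)).arg : Real.Angle) - p.arg‖ ^ 2
      ≤ ∑ i, 4 * ‖(starRingEnd ℂ) (AngularSync.measurementPhase x φ i) * u i - p‖ ^ 2 := by
        refine Finset.sum_le_sum fun i _ => ?_
        have h := AngularSync.norm_coe_arg_sub_sub_le (hphase i).1
          (AngularSync.norm_measurementPhase (x := x) (φ := φ) i) hp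
        rw [AngularSync.arg_measurementPhase] at h
        calc _ ≤ (2 * ‖(starRingEnd ℂ) (AngularSync.measurementPhase x φ i) * u i - p‖) ^ 2 := by
              refine pow_le_pow_left₀ (norm_nonneg _) (h.trans ?_) 2
              gcongr
              linarith [Real.pi_le_four]
          _ = _ := by ring
    _ ≤ 4 * (96 * (8 * AngularSync.noiseNormSq G ε /
          AngularSync.minEdgeModulus G x φ ε ^ 2) / AngularSync.spectralGap G ^ 2) := by
        rw [← Finset.mul_sum]
        refine mul_le_mul_of_nonneg_left (hsum.trans ?_) (by norm_num)
        gcongr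
    _ = _ := by ring
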